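/- Let $\Lambda$ be the ring of symmetric functions over $\mathbb{Q}$ in the variables $x_0,x_1,x_2,\dots$, let $m_\mu$ denote the monomial symmetric functions, and let $e_\lambda=e_{\lambda_1}e_{\lambda_2}\cdots$ denote the elementary symmetric functions. For an integer $k\ge 1$, let $\rho_k:\Lambda\to\Lambda$ be the $\mathbb{Q}$-linear map with $\rho_k(m_\mu)=m_{\mu/k}$ if every part of $\mu$ is divisible by $k$, and $\rho_k(m_\mu)=0$ otherwise. **Proposition.** Let $k\ge 1$ and $n\ge 0$ be integers. 1. There is a unique family of rational numbers $(c_\lambda)_{\lambda\vdash n}$ with $\rho_k(e_1^{kn})=\sum_{\lambda\vdash n}c_\lambda e_\lambda$. There is a unique family of rational numbers $\gamma^{(k)}_{n,d}$ ($0\le d\le\lfloor n/2\rfloor$) such that the specialization of $\rho_k(e_1^{kn})$ to two variables ($x_0=x$, $x_1=y$, $x_i=0$ for $i\ge 2$) equals $\sum_{d=0}^{\lfloor n/2\rfloor}\gamma^{(k)}_{n,d}\,(xy)^d(x+y)^{n-2d}$. Moreover $\gamma^{(k)}_{n,d}=c_{2^d1^{n-2d}}$ for every $0\le d\le \lfloor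 n/2\rfloor$; that is, $\gamma^{(k)}_{n,d}$ is the coefficient of $e_{2^d1^{n-2d}}$ in $\rho_k(e_1^{kn})$. 2. The numbers $\gamma^{(k)}_{n,d}$ are the gamma coefficients of the polynomial $P_{n,k}(z)=\sum_{m=0}^{n}\binom{nk}{mk}z^m$; that is, they are the unique rational numbers with $$P_{n,k}(z)=\sum_{d=0}^{\lfloor n/2\rfloor}\gamma^{(k)}_{n,d}\,z^d(1+z)^{n-2d}.$$ 3. $\gamma^{(k)}_{n,d}\ge 0$ for every $0\le d\le\lfloor n/2\rfloor$. 4. $P_{n,k}$ is the $k$-th Veronese section of $(1+z)^{kn}$ (for every $m\ge 0$, the coefficient of $z^m$ in $P_{n,k}$ is the coefficient of $z^{km}$ in $(1+z)^{kn}$). It is palindromic of degree $n$, and all its complex zeros are real and negative. -/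

import Mathlib

open scoped Polynomial

noncomputable section

namespace SymFn

open MvPowerSeries

/-- The ring `Λ` of symmetric functions over `ℚ`: formal power series of bounded degree in
countably many variables that are invariant under all permutations of the variables. -/
def Lam : Subalgebra ℚ (MvPowerSeries ℕ ℚ) where
  carrier := {f | (∀ σ : Equiv.Perm ℕ, rename σ f = f) ∧
    ∃ D : ℕ, ∀ α : ℕ →₀ ℕ, coeff α f ≠ 0 → α.degree ≤ D}
  mul_mem' := by
    classical
    rintro f g ⟨hf, D, hD⟩ ⟨hg, E, hE⟩
    refine ⟨fun σ => by rw [map_mul, hf, hg], D + E, fun α hα => ?_⟩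
    rw [coeff_mul] at hα
    obtain ⟨p, hp, hne⟩ := Finset.exists_ne_zero_of_sum_ne_zero hα
    have h1 := hD p.1 (left_ne_zero_of_mul hne)
    have h2 := hE p.2 (right_ne_zero_of_mul hne)
    rw [← Finset.HasAntidiagonal.mem_antidiagonal.mp hp, map_add]
    omega
  add_mem' := by
    rintro f g ⟨hf, D, hD⟩ ⟨hg, E, hE⟩
    refine ⟨fun σ => by rw [map_add, hf, hg], max D E, fun α hα => ?_⟩
    by_cases h : coeff α f = 0
    · have h' : coeff α g ≠ 0 := by
        intro h0
        exact hα (by rw [map_add, h, h0, add_zero])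
      exact (hE α h').trans (le_max_right _ _)
    · exact (hD α h).trans (le_max_left _ _)
  algebraMap_mem' := by
    classical
    intro r
    refine ⟨fun σ => AlgHom.commutes _ r, 0, fun α hα => ?_⟩
    by_contra h
    apply hα
    rw [MvPowerSeries.algebraMap_apply, coeff_C, if_neg]
    rintro rfl
    simp at h

/-- A power series is invariant under a permutation of the variables as soon as its
coefficients are invariant under permutations of the exponents. -/
theorem rename_eq_self {f : MvPowerSeries ℕ ℚ}
    (h : ∀ (σ : Equiv.Perm ℕ) (α : ℕ →₀ ℕ),
      coeff (α.embDomain σ.toEmbedding) f = coeff α f) (σ : Equiv.Perm ℕ) :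
    rename σ f = f := by
  ext β
  have hβ : β = (β.embDomain σ.symm.toEmbedding).embDomain σ.toEmbedding := by
    ext i
    obtain ⟨j, rfl⟩ := σ.surjective i
    have := Finsupp.embDomain_apply_self σ.toEmbedding (β.embDomain σ.symm.toEmbedding) j
    rw [Equiv.coe_toEmbedding] at this
    rw [this]
    have := Finsupp.embDomain_apply_self σ.symm.toEmbedding β (σ j)
    simpa using this.symm
  rw [hβ, h]
  exact coeff_embDomain_rename σ.toEmbedding f _

/-- Coefficients of a symmetric function are invariant under permutations of the exponents. -/
theorem coeff_embDomain (f : Lam) (σ : Equiv.Perm ℕ) (α : ℕ →₀ ℕ) :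
    coeff (α.embDomain σ.toEmbedding) (f : MvPowerSeries ℕ ℚ) = coeff α f.1 := by
  conv_lhs => rw [← f.2.1 σ]
  exact coeff_embDomain_rename σ.toEmbedding f.1 α

/-- The multiset of nonzero exponents of a monomial. -/
def exponents (α : ℕ →₀ ℕ) : Multiset ℕ := α.support.val.map α

theorem exponents_embDomain (σ : ℕ ↪ ℕ) (α : ℕ →₀ ℕ) :
    exponents (α.embDomain σ) = exponents α := by
  simp only [exponents, Finsupp.support_embDomain, Finset.map_val, Multiset.map_map]
  refine Multiset.map_congr rfl fun i _ => ?_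
  simp

theorem exponents_sum (α : ℕ →₀ ℕ) : (exponents α).sum = α.degree := rfl

/-- The sum of all monomials with a given multiset of nonzero exponents is a symmetric
function. -/
theorem mem_Lam_of_exponents (s : Multiset ℕ) :
    (fun α => if exponents α = s then 1 else 0 : MvPowerSeries ℕ ℚ) ∈ Lam := by
  refine ⟨rename_eq_self fun σ α => ?_, s.sum, fun α hα => ?_⟩
  · change (if _ then _ else _ : ℚ) = if _ then _ else _
    rw [exponents_embDomain]
  · change (if _ then _ else _ : ℚ) ≠ 0 at hα
    have h : exponents α = s := by
      by_contra h
      exact hα (if_neg h)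
    rw [← h, exponents_sum]

/-- The elementary symmetric function `e_r`: the sum of all squarefree monomials of degree
`r`, that is, of all monomials with exactly `r` nonzero exponents, all equal to `1`. -/
def e (r : ℕ) : Lam :=
  ⟨fun α => if exponents α = Multiset.replicate r 1 then 1 else 0, mem_Lam_of_exponents _⟩

/-- The monomial symmetric function `m_μ`: the sum of all monomials whose exponent vector is
a rearrangement of `μ` (padded by zeros). -/
def m {n : ℕ} (μ : n.Partition) : Lam :=
  ⟨fun α => if exponents α = μ.parts then 1 else 0, mem_Lam_of_exponents _⟩

/-- `e_λ`, the product of the `e_{λ_i}`. -/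
def ePart {n : ℕ} (μ : n.Partition) : Lam := (μ.parts.map e).prod

/-- The partition division map `ρ_k`: the coefficient of a monomial `x^α` in `ρ_k f` is the
coefficient of `x^{kα}` in `f`. In terms of the monomial symmetric functions (which span `Λ`,
see `span_m`), it is the linear map that sends `m_μ` to `m_{μ/k}` if all parts of `μ` are
divisible by `k` and to `0` otherwise, see `rowMap_m_scale` and `rowMap_m_eq_zero`. -/
def rowMap (k : ℕ) [NeZero k] : Lam →ₗ[ℚ] Lam where
  toFun f := ⟨fun α => coeff (k • α) f.1, by
    obtain ⟨D, hD⟩ := f.2.2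
    refine ⟨rename_eq_self fun σ α => ?_, D, fun α hα => ?_⟩
    · change coeff (k • α.embDomain σ.toEmbedding) f.1 = coeff (k • α) f.1
      rw [← coeff_embDomain f σ (k • α)]
      congr 2
      ext i
      obtain ⟨j, rfl⟩ := σ.surjective i
      have h := fun γ : ℕ →₀ ℕ => Finsupp.embDomain_apply_self σ.toEmbedding γ j
      simp only [Equiv.coe_toEmbedding] at h
      rw [h, Finsupp.smul_apply, Finsupp.smul_apply, h]
    · have h := hD _ hα
      rw [map_nsmul, smul_eq_mul] at h
      exact (Nat.le_mul_of_pos_left _ (NeZero.pos k)).trans h⟩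
  map_add' f g := rfl
  map_smul' r f := rfl

/-- The partition `kμ = (kμ₁, kμ₂, …)`. -/
def scale (k : ℕ) [NeZero k] {n : ℕ} (μ : n.Partition) : (k * n).Partition where
  parts := μ.parts.map (k * ·)
  parts_pos := by
    intro i hi
    obtain ⟨j, hj, rfl⟩ := Multiset.mem_map.mp hi
    exact Nat.mul_pos (NeZero.pos k) (μ.parts_pos hj)
  parts_sum := by
    rw [Multiset.sum_map_mul_left, Multiset.map_id', μ.parts_sum]

theorem exponents_nsmul (k : ℕ) [NeZero k] (α : ℕ →₀ ℕ) :
    exponents (k • α) = (exponents α).map (k * ·) := by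
  have h : (k • α).support = α.support := by
    ext i
    simp [NeZero.ne k]
  simp only [exponents, h, Multiset.map_map]
  rfl

theorem rowMap_m_scale (k : ℕ) [NeZero k] {n : ℕ} (μ : n.Partition) :
    rowMap k (m (scale k μ)) = m μ := by
  apply Subtype.ext
  funext α
  change (if exponents (k • α) = μ.parts.map (k * ·) then 1 else 0 : ℚ) =
    if exponents α = μ.parts then 1 else 0
  rw [exponents_nsmul]
  simp only [(Multiset.map_injective (mul_right_injective₀ (NeZero.ne k))).eq_iff]

theorem rowMap_m_eq_zero (k : ℕ) [NeZero k] {n : ℕ} (μ : n.Partition)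
    (h : ¬ ∀ p ∈ μ.parts, k ∣ p) : rowMap k (m μ) = 0 := by
  apply Subtype.ext
  funext α
  change (if exponents (k • α) = μ.parts then 1 else 0 : ℚ) = 0
  refine if_neg fun h' => h fun p hp => ?_
  rw [← h', exponents_nsmul] at hp
  obtain ⟨j, -, rfl⟩ := Multiset.mem_map.mp hp
  exact dvd_mul_right k j

/-- Two monomials with the same nonzero exponents differ by a permutation of the variables. -/
theorem exists_perm_of_exponents_eq {α β : ℕ →₀ ℕ} (h : exponents α = exponents β) :
    ∃ σ : Equiv.Perm ℕ, α.embDomain σ.toEmbedding = β := by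
  classical
  set T : Finset ℕ := α.support ∪ β.support with hT
  have key : ∀ γ : ℕ →₀ ℕ, γ.support ⊆ T →
      T.val.map γ = exponents γ + Multiset.replicate (T.card - (exponents γ).card) 0 := by
    intro γ hγ
    have h1 : T.val = γ.support.val + (T \ γ.support).val := by
      rw [← Finset.disjUnion_val _ _ Finset.disjoint_sdiff, Finset.disjUnion_eq_union,
        Finset.union_sdiff_of_subset hγ]
    rw [h1, Multiset.map_add]
    congr 1
    rw [Multiset.eq_replicate]
    refine ⟨?_, ?_⟩
    · rw [Multiset.card_map, exponents, Multiset.card_map, Finset.card_val, Finset.card_val,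
        Finset.card_sdiff_of_subset hγ]
    · intro b hb
      obtain ⟨i, hi, rfl⟩ := Multiset.mem_map.mp hb
      simpa using (Finset.mem_sdiff.mp hi).2
  have h2 : T.val.map α = T.val.map β := by
    rw [key α Finset.subset_union_left, key β Finset.subset_union_right, h]
  have h3 : ∀ (γ : ℕ →₀ ℕ) (c : ℕ),
      Fintype.card {i : T // γ i = c} = (T.val.map γ).count c := by
    intro γ c
    rw [Multiset.count_map, ← Finset.filter_val, Finset.card_val, Fintype.card_subtype,
      ← Finset.card_map (Function.Embedding.subtype (· ∈ T))]
    congr 1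
    ext i
    simp only [Finset.mem_map, Finset.mem_filter, Finset.mem_univ, true_and,
      Function.Embedding.subtype_apply, Subtype.exists, exists_and_right, exists_eq_right]
    constructor
    · rintro ⟨hi, hc⟩
      exact ⟨hi, hc.symm⟩
    · rintro ⟨hi, hc⟩
      exact ⟨hi, hc.symm⟩
  have h4 : ∀ c : ℕ, Nonempty ({i : T // α i = c} ≃ {i : T // β i = c}) := by
    intro c
    rw [← Fintype.card_eq, h3, h3, h2]
  let τ : Equiv.Perm T := Equiv.ofFiberEquiv fun c => (h4 c).some
  have hτ : ∀ i : T, β (τ i) = α i := fun i =>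
    Equiv.ofFiberEquiv_map (g := fun i : T => β i) (fun c => (h4 c).some) i
  refine ⟨Equiv.Perm.ofSubtype τ, ?_⟩
  ext i
  obtain ⟨j, rfl⟩ := (Equiv.Perm.ofSubtype τ).surjective i
  have h5 := Finsupp.embDomain_apply_self (Equiv.Perm.ofSubtype τ).toEmbedding α j
  rw [Equiv.coe_toEmbedding] at h5
  rw [h5]
  by_cases hj : j ∈ T
  · rw [Equiv.Perm.ofSubtype_apply_of_mem τ hj]
    exact (hτ ⟨j, hj⟩).symm
  · rw [Equiv.Perm.ofSubtype_apply_of_not_mem τ hj]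
    rw [hT, Finset.mem_union, not_or] at hj
    rw [Finsupp.notMem_support_iff.mp hj.1, Finsupp.notMem_support_iff.mp hj.2]

/-- The monomial symmetric functions span `Λ`. -/
theorem span_m : Submodule.span ℚ {f : Lam | ∃ (n : ℕ) (μ : n.Partition), f = m μ} = ⊤ := by
  classical
  rw [eq_top_iff]
  rintro f -
  obtain ⟨D, hD⟩ := f.2.2
  let c : Multiset ℕ → ℚ := fun s =>
    if h : ∃ α : ℕ →₀ ℕ, exponents α = s then coeff h.choose f.1 else 0
  have hc : ∀ β : ℕ →₀ ℕ, c (exponents β) = coeff β f.1 := by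
    intro β
    have h : ∃ α : ℕ →₀ ℕ, exponents α = exponents β := ⟨β, rfl⟩
    obtain ⟨σ, hσ⟩ := exists_perm_of_exponents_eq h.choose_spec
    simp only [c, dif_pos h]
    rw [← coeff_embDomain f σ, hσ]
  have hf : f = ∑ n ∈ Finset.range (D + 1), ∑ μ : n.Partition, c μ.parts • m μ := by
    apply Subtype.ext
    ext β
    simp only [AddSubmonoidClass.coe_finsetSum, map_sum]
    have hm : ∀ (n : ℕ) (μ : n.Partition), coeff β ((c μ.parts • m μ : Lam) : MvPowerSeries ℕ ℚ)
        = if exponents β = μ.parts then c μ.parts else 0 := by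
      intro n μ
      change c μ.parts * (if exponents β = μ.parts then 1 else 0) = _
      simp
    simp only [hm]
    by_cases hβ : β.degree ≤ D
    · have hpos : ∀ {i : ℕ}, i ∈ exponents β → 0 < i := by
        intro i hi
        obtain ⟨j, hj, rfl⟩ := Multiset.mem_map.mp hi
        exact Nat.pos_of_ne_zero (Finsupp.mem_support_iff.mp hj)
      rw [Finset.sum_eq_single β.degree, Finset.sum_eq_single ⟨exponents β, hpos, exponents_sum β⟩]
      · simp [hc]
      · intro μ _ hμ
        exact if_neg fun h => hμ (Nat.Partition.ext h.symm)
      · simp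
      · intro n _ hn
        refine Finset.sum_eq_zero fun μ _ => if_neg fun h => hn ?_
        rw [← exponents_sum, h, μ.parts_sum]
      · intro h
        exact absurd (Finset.mem_range.mpr (Nat.lt_succ_of_le hβ)) h
    · have h0 : coeff β f.1 = 0 := by
        by_contra h
        exact hβ (hD β h)
      rw [h0]
      symm
      refine Finset.sum_eq_zero fun n hn => Finset.sum_eq_zero fun μ _ => if_neg fun h => hβ ?_
      rw [← exponents_sum, h, μ.parts_sum]
      exact Nat.lt_succ_iff.mp (Finset.mem_range.mp hn)
  rw [hf]
  exact Submodule.sum_mem _ fun n _ => Submodule.sum_mem _ fun μ _ =>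
    Submodule.smul_mem _ _ (Submodule.subset_span ⟨n, μ, rfl⟩)

/-- Specialization to two variables: `x₀ = x`, `x₁ = y` and `x_i = 0` for `i ≥ 2`. -/
def twoVar (f : Lam) : MvPowerSeries (Fin 2) ℚ := killCompl Fin.valEmbedding f.1

/-- The partition `2^d 1^{n-2d}` of `n`, for `0 ≤ d ≤ ⌊n/2⌋`. -/
def twoOne (n : ℕ) (d : Fin (n / 2 + 1)) : n.Partition where
  parts := Multiset.replicate (d : ℕ) 2 + Multiset.replicate (n - 2 * (d : ℕ)) 1
  parts_pos := by
    intro i hi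
    rcases Multiset.mem_add.mp hi with h | h <;> rw [Multiset.eq_of_mem_replicate h] <;> norm_num
  parts_sum := by
    have := d.2
    simp only [Multiset.sum_add, Multiset.sum_replicate, smul_eq_mul]
    omega

/-- `c` is the family of coefficients of an expansion of `f` in the `e_λ`, `λ ⊢ n`. -/
def IsEExpansion {n : ℕ} (f : Lam) (c : n.Partition → ℚ) : Prop :=
  f = ∑ μ : n.Partition, c μ • ePart μ

/-- `f(x, y) = ∑_d γ_d (xy)^d (x + y)^{n-2d}`, the sum being over `0 ≤ d ≤ ⌊n/2⌋`. -/
def IsTwoVarExpansion (n : ℕ) (f : Lam) (γ : Fin (n / 2 + 1) → ℚ) : Prop :=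
  twoVar f = ∑ d : Fin (n / 2 + 1),
    γ d • ((X 0 * X 1) ^ (d : ℕ) * (X 0 + X 1) ^ (n - 2 * (d : ℕ)))

/-- `γ` is the vector of gamma coefficients of `p`:
`p(z) = ∑_d γ_d z^d (1 + z)^{n-2d}`, the sum being over `0 ≤ d ≤ ⌊n/2⌋`. -/
def IsGammaExpansion (n : ℕ) (p : ℚ[X]) (γ : Fin (n / 2 + 1) → ℚ) : Prop :=
  p = ∑ d : Fin (n / 2 + 1),
    γ d • ((Polynomial.X : ℚ[X]) ^ (d : ℕ) * (1 + Polynomial.X) ^ (n - 2 * (d : ℕ)))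

/-- The polynomial `P_{n,k}(z) = ∑_{m=0}^n C(nk, mk) z^m`. -/
def P (n k : ℕ) : ℚ[X] :=
  ∑ m ∈ Finset.range (n + 1), Polynomial.monomial m ((n * k).choose (m * k) : ℚ)

end SymFn

end

/-! Three ideas carry the proof.

Zeros. Let S be the shift on complex sequences and let b have `z ^ m` at index `m * k` and 0
elsewhere. Then P_{n,k}(z) is the entry at 0 of (1 + S)^{nk} b. For Im z > 0, already (1 + S)^{k-1}
b has no zero entry and spirals outwards or inwards: its phases increase weakly, by arg z < π per
period. Adding neighbours keeps the new phase between the two old ones, so the spiral property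
survives every further factor 1 + S (`IsSpiral.add_shift`) and no entry ever vanishes. Conjugation
handles Im z < 0, and positivity of the coefficients excludes z ≥ 0.

Nonnegativity. If P_{n,k}(z) = (1 + z)^n G(z / (1 + z)^2), then G has the gamma coefficients as its
coefficients. Each zero w of G has the form z / (1 + z)^2 with z a zero of P_{n,k}, hence is real
and nonpositive. As G(0) = 1, all coefficients of G are nonnegative.

Symmetric functions. The e_λ with λ ⊢ n are independent by the fundamental theorem in n variables,
and a dimension count makes them span degree n. In two variables e_r = 0 for r > 2, so only the
terms λ = 2^d 1^{n-2d} survive, while ρ_k(e_1^{kn}) becomes the homogenization of P_{n,k}. Setting y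
= 1 identifies the coefficients c_{2^d 1^{n-2d}} with the gamma coefficients, and this also supplies
their existence. -/

namespace SymFn

/-! ### Zeros of sections of `(1 + z)^N` -/

/-- If two nonzero complex numbers differ in argument by `δ ∈ [0, π)`, then the argument of their
sum lies between their arguments. -/
theorem add_mul_exp_ne_zero_and_arg_mem {r s δ : ℝ} (hr : 0 < r) (hs : 0 < s) (h0 : 0 ≤ δ)
    (hπ : δ < Real.pi) :
    (r + s * Complex.exp (δ * Complex.I) : ℂ) ≠ 0 ∧
      0 ≤ (r + s * Complex.exp (δ * Complex.I) : ℂ).arg ∧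
      (r + s * Complex.exp (δ * Complex.I) : ℂ).arg ≤ δ := by
  set w : ℂ := r + s * Complex.exp (δ * Complex.I) with hw
  have hre : w.re = r + s * Real.cos δ := by
    simp [hw, Complex.exp_ofReal_mul_I_re]
  have him : w.im = s * Real.sin δ := by
    simp [hw, Complex.exp_ofReal_mul_I_im]
  rcases h0.eq_or_lt with rfl | hδ
  · have : w = ((r + s : ℝ) : ℂ) := by simp [hw]
    rw [this, Complex.arg_ofReal_of_nonneg (by positivity)]
    refine ⟨?_, le_rfl, le_rfl⟩
    exact_mod_cast (by positivity : r + s ≠ 0)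
  have hsin : 0 < Real.sin δ := Real.sin_pos_of_pos_of_lt_pi hδ hπ
  have himpos : 0 < w.im := him ▸ mul_pos hs hsin
  have hne : w ≠ 0 := fun h => by simp [h] at himpos
  refine ⟨hne, Complex.arg_nonneg_iff.mpr himpos.le, ?_⟩
  by_contra! hlt
  have h1 : 0 < Real.sin (w.arg - δ) :=
    Real.sin_pos_of_pos_of_lt_pi (by linarith) (by linarith [Complex.arg_le_pi w])
  -- Both sides are the imaginary part of w * exp(-iδ) = r * exp(-iδ) + s. An argument above δ would
  -- make it positive.
  have h2 : ‖w‖ * Real.sin (w.arg - δ) = -(r * Real.sin δ) := by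
    have h3 : ‖w‖ * Real.sin w.arg = w.im := Complex.norm_mul_sin_arg w
    have h4 : ‖w‖ * Real.cos w.arg = w.re := Complex.norm_mul_cos_arg w
    rw [Real.sin_sub, mul_sub, ← mul_assoc, ← mul_assoc, h3, h4, hre, him]
    ring
  have h5 : 0 < ‖w‖ * Real.sin (w.arg - δ) := mul_pos (norm_pos_iff.mpr hne) h1
  nlinarith [mul_pos hr hsin]

/-- A sequence of nonzero complex numbers with `b (j + k) = z * b j` whose arguments can be lifted
to a monotone sequence that increases by `arg z` over each period. -/
structure IsSpiral (k : ℕ) (z : ℂ) (b : ℕ → ℂ) : Prop where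
  shift : ∀ j, b (j + k) = z * b j
  exists_arg : ∃ θ : ℕ → ℝ, Monotone θ ∧ (∀ j, θ (j + k) = θ j + z.arg) ∧
    ∀ j, ∃ r : ℝ, 0 < r ∧ b j = r * Complex.exp (θ j * Complex.I)

theorem IsSpiral.ne_zero {k : ℕ} {z : ℂ} {b : ℕ → ℂ} (h : IsSpiral k z b) (j : ℕ) : b j ≠ 0 := by
  obtain ⟨θ, -, -, hr⟩ := h.exists_arg
  obtain ⟨r, hr, h⟩ := hr j
  rw [h]
  exact mul_ne_zero (by exact_mod_cast hr.ne') (Complex.exp_ne_zero _)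

/-- Consecutive phases differ by at most the increase over one period, which is arg z < π. So two
neighbours never cancel, and the phase of their sum lies in [θ j, θ (j + 1)]; these intervals are in
increasing order, so monotonicity persists. -/
theorem IsSpiral.add_shift {k : ℕ} [NeZero k] {z : ℂ} (hz : 0 < z.im) {b : ℕ → ℂ}
    (h : IsSpiral k z b) : IsSpiral k z fun j => b j + b (j + 1) := by
  have hz0 : z ≠ 0 := fun h => by simp [h] at hz
  have hzπ : z.arg < Real.pi := Complex.arg_lt_pi_iff.mpr (Or.inr hz.ne')
  obtain ⟨θ, hmono, hper, hr⟩ := h.exists_arg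
  choose r hrpos hb using hr
  have hs : ∀ j, b (j + k) + b (j + k + 1) = z * (b j + b (j + 1)) := by
    intro j
    rw [mul_add, ← h.shift, ← h.shift, add_right_comm j 1 k]
  refine ⟨hs, ?_⟩
  -- The sum is rotated back by θ j, so that its principal argument is the phase increment without
  -- ambiguity modulo 2π.
  let w : ℕ → ℂ := fun j => r j + r (j + 1) * Complex.exp ((θ (j + 1) - θ j : ℝ) * Complex.I)
  have hbw : ∀ j, b j + b (j + 1) = w j * Complex.exp (θ j * Complex.I) := by
    intro j
    simp only [w]
    rw [hb j, hb (j + 1), add_mul, mul_assoc (r (j + 1) : ℂ), ← Complex.exp_add]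
    congr 3
    push_cast
    ring
  have hw : ∀ j, w j ≠ 0 ∧ 0 ≤ (w j).arg ∧ (w j).arg ≤ θ (j + 1) - θ j := by
    intro j
    refine add_mul_exp_ne_zero_and_arg_mem (hrpos j) (hrpos (j + 1))
      (sub_nonneg.mpr (hmono j.le_succ)) ?_
    have h1 : θ (j + 1) ≤ θ (j + k) := hmono (Nat.add_le_add_left (NeZero.pos k) j)
    rw [hper] at h1
    linarith
  refine ⟨fun j => θ j + (w j).arg, monotone_nat_of_le_succ fun j => ?_, fun j => ?_, fun j => ?_⟩
  · linarith [(hw j).2.2, (hw (j + 1)).2.1]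
  -- Over one period the rotated sum is only scaled by a positive real, so its argument is
  -- k-periodic.
  · have h1 : w (j + k) = (‖z‖ : ℝ) * w j := by
      have h2 := hbw (j + k)
      have h3 : Complex.exp (θ (j + k) * Complex.I) =
          Complex.exp (θ j * Complex.I) * Complex.exp (z.arg * Complex.I) := by
        rw [hper, ← Complex.exp_add]
        congr 1
        push_cast
        ring
      rw [hs j, hbw j, h3] at h2
      nth_rewrite 1 [← Complex.norm_mul_exp_arg_mul_I z] at h2
      refine mul_right_cancel₀ (mul_ne_zero (Complex.exp_ne_zero (θ j * Complex.I))
        (Complex.exp_ne_zero (z.arg * Complex.I))) ?_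
      rw [← h2]
      ring
    change θ (j + k) + (w (j + k)).arg = θ j + (w j).arg + z.arg
    rw [h1, Complex.arg_real_mul _ (norm_pos_iff.mpr hz0), hper]
    ring
  · refine ⟨‖w j‖, norm_pos_iff.mpr (hw j).1, ?_⟩
    rw [hbw j]
    nth_rewrite 1 [← Complex.norm_mul_exp_arg_mul_I (w j)]
    rw [mul_assoc, ← Complex.exp_add]
    congr 2
    push_cast
    ring

/-- The shift operator on sequences. -/
noncomputable def shiftOp : Module.End ℂ (ℕ → ℂ) := LinearMap.funLeft ℂ ℂ Nat.succ

theorem shiftOp_pow_apply (i : ℕ) (b : ℕ → ℂ) (j : ℕ) : (shiftOp ^ i) b j = b (i + j) := by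
  induction i generalizing j with
  | zero => simp
  | succ i ih =>
    rw [pow_succ', Module.End.mul_apply]
    change (shiftOp ^ i) b (j + 1) = _
    rw [ih]
    congr 1
    ring

theorem one_add_shiftOp_pow_apply (N : ℕ) (b : ℕ → ℂ) (j : ℕ) :
    ((1 + shiftOp) ^ N) b j = ∑ i ∈ Finset.range (N + 1), (N.choose i : ℂ) * b (i + j) := by
  rw [add_comm, (Commute.one_right shiftOp).add_pow, LinearMap.sum_apply, Finset.sum_apply]
  refine Finset.sum_congr rfl fun i _ => ?_
  rw [one_pow, mul_one, (Nat.cast_commute _ _).eq.symm, Module.End.mul_apply,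
    Module.End.natCast_apply, Pi.smul_apply, shiftOp_pow_apply, nsmul_eq_mul]

theorem IsSpiral.one_add_shiftOp_pow {k : ℕ} [NeZero k] {z : ℂ} (hz : 0 < z.im) {b : ℕ → ℂ}
    (h : IsSpiral k z b) (N : ℕ) : IsSpiral k z (((1 + shiftOp) ^ N) b) := by
  induction N with
  | zero => simpa using h
  | succ N ih =>
    rw [pow_succ', Module.End.mul_apply]
    exact ih.add_shift hz

/-- The sequence with value `z ^ m` at the index `m * k` and `0` at indices not divisible
by `k`. -/
noncomputable def sparsePow (k : ℕ) (z : ℂ) (j : ℕ) : ℂ := if k ∣ j then z ^ (j / k) else 0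

/-- The window j, …, j + k - 1 contains exactly one multiple of k, namely ck with c = ⌈j/k⌉, so only
one term of the binomial sum survives. -/
theorem one_add_shiftOp_pow_sparsePow (k : ℕ) [NeZero k] (z : ℂ) (j : ℕ) :
    ((1 + shiftOp) ^ (k - 1)) (sparsePow k z) j =
      ((k - 1).choose (((j + (k - 1)) / k) * k - j) : ℂ) * z ^ ((j + (k - 1)) / k) := by
  have hk : 0 < k := NeZero.pos k
  set c := (j + (k - 1)) / k with hc
  have h1 : c * k ≤ j + (k - 1) := Nat.div_mul_le_self _ _
  have h2 : j + (k - 1) < (c + 1) * k := by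
    rw [mul_comm]
    exact Nat.lt_mul_div_succ _ hk
  have h3 : (c + 1) * k = c * k + k := by ring
  rw [one_add_shiftOp_pow_apply, Finset.sum_eq_single (c * k - j)]
  · rw [Nat.sub_add_cancel (by omega), sparsePow, if_pos (dvd_mul_left k c),
      Nat.mul_div_cancel _ hk]
  · intro i hi hne
    rw [Finset.mem_range] at hi
    rw [sparsePow, if_neg, mul_zero]
    rintro ⟨t, ht⟩
    apply hne
    have : t = c := by
      have h4 : k * t < k * (c + 1) := by rw [mul_comm k (c + 1)]; omega
      have h5 : c * k < (t + 1) * k := by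
        have : (t + 1) * k = k * t + k := by ring
        omega
      have := Nat.lt_of_mul_lt_mul_left h4
      have := Nat.lt_of_mul_lt_mul_right h5
      omega
    rw [this, mul_comm k c] at ht
    omega
  · intro h
    exact absurd (Finset.mem_range.mpr (by omega)) h

/-- The factor (1 + S)^{k-1} fills the gaps of `sparsePow`, whose zero entries have no phase. The
resulting phase is the step function ⌈j/k⌉ * arg z. -/
theorem isSpiral_one_add_shiftOp_pow_sparsePow (k : ℕ) [NeZero k] {z : ℂ} (hz : 0 < z.im) :
    IsSpiral k z (((1 + shiftOp) ^ (k - 1)) (sparsePow k z)) := by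
  have hk : 0 < k := NeZero.pos k
  have hz0 : z ≠ 0 := fun h => by simp [h] at hz
  have hdiv : ∀ j, (j + k + (k - 1)) / k = (j + (k - 1)) / k + 1 := by
    intro j
    rw [add_right_comm, Nat.add_div_right _ hk]
  refine ⟨fun j => ?_, fun j => ((j + (k - 1)) / k : ℕ) * z.arg, ?_, fun j => ?_, fun j => ?_⟩
  · rw [one_add_shiftOp_pow_sparsePow, one_add_shiftOp_pow_sparsePow, hdiv, pow_succ, add_one_mul,
      Nat.add_sub_add_right]
    ring
  · intro i j hij
    refine mul_le_mul_of_nonneg_right ?_ (Complex.arg_nonneg_iff.mpr hz.le)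
    exact_mod_cast Nat.div_le_div_right (Nat.add_le_add_right hij _)
  · simp only [hdiv]
    push_cast
    ring
  · rw [one_add_shiftOp_pow_sparsePow]
    set c := (j + (k - 1)) / k with hc
    have h1 : c * k ≤ j + (k - 1) := Nat.div_mul_le_self _ _
    refine ⟨(k - 1).choose (c * k - j) * ‖z‖ ^ c, ?_, ?_⟩
    · exact mul_pos (by exact_mod_cast Nat.choose_pos (by omega))
        (pow_pos (norm_pos_iff.mpr hz0) _)
    · nth_rewrite 1 [← Complex.norm_mul_exp_arg_mul_I z]
      rw [mul_pow, ← Complex.exp_nat_mul]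
      push_cast
      rw [mul_assoc, mul_assoc (c : ℂ)]

theorem aeval_P (n k : ℕ) {A : Type*} [CommRing A] [Algebra ℚ A] (z : A) :
    Polynomial.aeval z (P n k) =
      ∑ m ∈ Finset.range (n + 1), ((n * k).choose (m * k) : A) * z ^ m := by
  simp [P, Polynomial.aeval_monomial]

theorem one_add_shiftOp_pow_sparsePow_zero (n k : ℕ) [NeZero k] (z : ℂ) :
    ((1 + shiftOp) ^ (n * k)) (sparsePow k z) 0 = Polynomial.aeval z (P n k) := by
  have hk : 0 < k := NeZero.pos k
  rw [one_add_shiftOp_pow_apply, aeval_P]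
  symm
  refine Finset.sum_of_injOn (· * k) (fun a _ b _ h => Nat.eq_of_mul_eq_mul_right hk h) ?_ ?_ ?_
  · intro m hm
    have := Finset.mem_range.mp (Finset.mem_coe.mp hm)
    exact Finset.mem_coe.mpr (Finset.mem_range.mpr
      (Nat.lt_succ_of_le (Nat.mul_le_mul_right k (Nat.lt_succ_iff.mp this))))
  · intro i hi hni
    rw [add_zero, sparsePow, if_neg, mul_zero]
    rintro ⟨t, rfl⟩
    refine hni ⟨t, ?_, mul_comm t k⟩
    rw [Finset.mem_range, mul_comm k t] at hi
    exact Finset.mem_coe.mpr (Finset.mem_range.mpr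
      (Nat.lt_succ_of_le (Nat.le_of_mul_le_mul_right (Nat.lt_succ_iff.mp hi) hk)))
  · intro m _
    rw [add_zero, sparsePow, if_pos (dvd_mul_left k m), Nat.mul_div_cancel _ hk]

theorem aeval_P_ne_zero_of_im_pos (n k : ℕ) [NeZero k] {z : ℂ} (hz : 0 < z.im) :
    Polynomial.aeval z (P n k) ≠ 0 := by
  rcases Nat.eq_zero_or_pos n with rfl | hn
  · simp [aeval_P]
  -- The first k - 1 factors create the spiral and the remaining ones preserve it; n ≥ 1 ensures
  -- that there are enough factors.
  have h1 : n * k = (n * k - (k - 1)) + (k - 1) := by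
    have : k ≤ n * k := Nat.le_mul_of_pos_left k hn
    omega
  rw [← one_add_shiftOp_pow_sparsePow_zero, h1, pow_add, Module.End.mul_apply]
  exact ((isSpiral_one_add_shiftOp_pow_sparsePow k hz).one_add_shiftOp_pow hz _).ne_zero 0

theorem im_eq_zero_and_re_neg_of_aeval_P_eq_zero (n k : ℕ) [NeZero k] {z : ℂ}
    (h : Polynomial.aeval z (P n k) = 0) : z.im = 0 ∧ z.re < 0 := by
  have him : z.im = 0 := by
    rcases lt_trichotomy z.im 0 with hz | hz | hz
    · refine absurd ?_ (aeval_P_ne_zero_of_im_pos n k (z := (starRingEnd ℂ) z) (by simpa using hz))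
      have := congrArg (starRingEnd ℂ) h
      rw [aeval_P] at this ⊢
      simpa using this
    · exact hz
    · exact absurd h (aeval_P_ne_zero_of_im_pos n k hz)
  refine ⟨him, ?_⟩
  by_contra! hre
  have hz : z = (z.re : ℂ) := Complex.ext rfl (by simpa using him)
  rw [hz, aeval_P] at h
  have h1 : ∑ m ∈ Finset.range (n + 1), ((n * k).choose (m * k) : ℝ) * z.re ^ m = 0 := by
    exact_mod_cast h
  rw [Finset.sum_range_succ'] at h1
  have h2 : 0 ≤ ∑ m ∈ Finset.range n, ((n * k).choose ((m + 1) * k) : ℝ) * z.re ^ (m + 1) :=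
    Finset.sum_nonneg fun m _ => by positivity
  simp at h1
  linarith

/-! ### The Veronese section and palindromicity -/

theorem coeff_P (n k : ℕ) [NeZero k] (m : ℕ) :
    (P n k).coeff m = ((n * k).choose (m * k) : ℚ) := by
  rw [P, Polynomial.finsetSum_coeff]
  simp only [Polynomial.coeff_monomial]
  rw [Finset.sum_ite_eq' (Finset.range (n + 1)) m (fun m => ((n * k).choose (m * k) : ℚ))]
  split_ifs with h
  · rfl
  · rw [Finset.mem_range, not_lt] at h
    rw [Nat.choose_eq_zero_of_lt, Nat.cast_zero]
    exact Nat.mul_lt_mul_of_pos_right h (NeZero.pos k)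

theorem P_eq_contract (n k : ℕ) [NeZero k] :
    P n k = Polynomial.contract k ((1 + Polynomial.X) ^ (k * n)) := by
  ext m
  rw [coeff_P, Polynomial.coeff_contract (NeZero.ne k), Polynomial.coeff_one_add_X_pow,
    mul_comm n k]

theorem natDegree_P (n k : ℕ) [NeZero k] : (P n k).natDegree = n := by
  refine Polynomial.natDegree_eq_of_le_of_coeff_ne_zero ?_ ?_
  · rw [Polynomial.natDegree_le_iff_coeff_eq_zero]
    intro m hm
    rw [coeff_P, Nat.choose_eq_zero_of_lt, Nat.cast_zero]
    exact Nat.mul_lt_mul_of_pos_right hm (NeZero.pos k)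
  · rw [coeff_P, Nat.choose_self]
    norm_num

theorem reverse_P (n k : ℕ) [NeZero k] : (P n k).reverse = P n k := by
  ext m
  rw [Polynomial.coeff_reverse, natDegree_P]
  rcases le_or_gt m n with h | h
  · rw [Polynomial.revAt_le h, coeff_P, coeff_P, Nat.sub_mul,
      Nat.choose_symm (Nat.mul_le_mul_right k h)]
  · rw [Polynomial.revAt_eq_self_of_lt h]

/-! ### Gamma coefficients -/

theorem coeff_X_pow_mul_one_add_X_pow_self (d a : ℕ) :
    ((Polynomial.X : ℚ[X]) ^ d * (1 + Polynomial.X) ^ a).coeff d = 1 := by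
  simp [Polynomial.coeff_X_pow_mul', Polynomial.coeff_one_add_X_pow]

theorem coeff_X_pow_mul_of_lt {d j : ℕ} (h : d < j) (p : ℚ[X]) :
    ((Polynomial.X : ℚ[X]) ^ j * p).coeff d = 0 := by
  rw [Polynomial.coeff_X_pow_mul', if_neg (not_le.mpr h)]

/-- The polynomials z^d (1 + z)^{n-2d} are unitriangular: the lowest term is z^d with coefficient 1.
Comparing coefficients from the bottom up determines each γ_d. -/
theorem IsGammaExpansion.unique {n : ℕ} {p : ℚ[X]} {γ γ' : Fin (n / 2 + 1) → ℚ}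
    (h : IsGammaExpansion n p γ) (h' : IsGammaExpansion n p γ') : γ' = γ := by
  have key : ∀ (N : ℕ) (d : Fin (n / 2 + 1)), (d : ℕ) = N → γ' d = γ d := by
    intro N
    induction N using Nat.strong_induction_on with
    | _ N ih =>
      intro d hd
      have h1 := congrArg (Polynomial.coeff · N) (h'.symm.trans h)
      simp only [Polynomial.finsetSum_coeff, Polynomial.coeff_smul, smul_eq_mul] at h1
      rw [← Finset.add_sum_erase _ _ (Finset.mem_univ d),
        ← Finset.add_sum_erase _ _ (Finset.mem_univ d), ← hd,
        coeff_X_pow_mul_one_add_X_pow_self, mul_one, mul_one] at h1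
      have h2 : ∀ i ∈ Finset.univ.erase d,
          γ' i * ((Polynomial.X : ℚ[X]) ^ (i : ℕ) *
            (1 + Polynomial.X) ^ (n - 2 * (i : ℕ))).coeff d =
          γ i * ((Polynomial.X : ℚ[X]) ^ (i : ℕ) *
            (1 + Polynomial.X) ^ (n - 2 * (i : ℕ))).coeff d := by
        intro i hi
        rcases lt_or_gt_of_ne (Fin.val_ne_of_ne (Finset.ne_of_mem_erase hi)) with hlt | hlt
        · rw [ih i (hd ▸ hlt) i rfl]
        · rw [coeff_X_pow_mul_of_lt hlt, mul_zero, mul_zero]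
      rw [Finset.sum_congr rfl h2] at h1
      exact add_right_cancel h1
  exact funext fun d => key d d rfl

/-- A real polynomial that is positive at `0` and has only real nonpositive zeros has nonnegative
coefficients. -/
theorem coeff_nonneg_of_zeros_real_nonpos (G : ℝ[X]) (h0 : 0 < G.eval 0)
    (h : ∀ w : ℂ, Polynomial.aeval w G = 0 → w.im = 0 ∧ w.re ≤ 0) (i : ℕ) : 0 ≤ G.coeff i := by
  induction hN : G.natDegree generalizing G i with
  | zero =>
    rw [Polynomial.eq_C_of_natDegree_eq_zero hN] at h0 ⊢
    rw [Polynomial.eval_C] at h0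
    rw [Polynomial.coeff_C]
    split_ifs
    · exact h0.le
    · exact le_rfl
  | succ N ih =>
    have hdeg : G.degree ≠ 0 := by
      intro h
      have := Polynomial.natDegree_eq_zero_iff_degree_le_zero.mpr h.le
      omega
    obtain ⟨w, hw⟩ := IsAlgClosed.exists_aeval_eq_zero ℂ G hdeg
    obtain ⟨him, hre⟩ := h w hw
    have hwr : w = algebraMap ℝ ℂ w.re := Complex.ext (by simp) (by simpa using him)
    rw [hwr, Polynomial.aeval_algebraMap_apply] at hw
    have hroot : G.IsRoot w.re := by
      rw [Polynomial.IsRoot.def, ← Polynomial.coe_aeval_eq_eval]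
      exact (map_eq_zero_iff _ (algebraMap ℝ ℂ).injective).mp hw
    -- The factor X - w has nonnegative coefficients because w ≤ 0, and H inherits both hypotheses,
    -- so the claim follows by induction on the degree.
    obtain ⟨H, rfl⟩ := Polynomial.dvd_iff_isRoot.mpr hroot
    rw [Polynomial.eval_mul, Polynomial.eval_sub, Polynomial.eval_X, Polynomial.eval_C,
      zero_sub] at h0
    have hH0 : 0 < H.eval 0 := pos_of_mul_pos_right h0 (by linarith)
    have hHne : H ≠ 0 := by
      rintro rfl
      simp at hH0
    have hHdeg : H.natDegree = N := by
      rw [Polynomial.natDegree_mul (Polynomial.X_sub_C_ne_zero _) hHne,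
        Polynomial.natDegree_X_sub_C] at hN
      omega
    have hH := fun i => ih H hH0 (fun u hu => h u (by rw [map_mul, hu, mul_zero])) i hHdeg
    rw [sub_mul, Polynomial.coeff_sub, Polynomial.coeff_C_mul]
    have h1 : 0 ≤ (Polynomial.X * H).coeff i := by
      cases i with
      | zero => simp
      | succ i => rw [Polynomial.coeff_X_mul]; exact hH i
    nlinarith [mul_nonneg (neg_nonneg.mpr hre) (hH i)]

/-- For w ≠ 0 this is the genuine quadratic w z² + (2w - 1) z + w = 0. It lifts a zero of the gamma
polynomial to a zero of P_{n,k}. -/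
theorem exists_eq_mul_one_add_sq {w : ℂ} (hw : w ≠ 0) : ∃ z : ℂ, z = w * (1 + z) ^ 2 := by
  obtain ⟨s, hs⟩ := IsAlgClosed.exists_pow_nat_eq (discrim w (2 * w - 1) w) (n := 2) two_pos
  obtain ⟨z, hz⟩ := exists_quadratic_eq_zero hw ⟨s, by rw [← hs, sq]⟩
  exact ⟨z, by linear_combination (-1 : ℂ) * hz⟩

theorem IsGammaExpansion.nonneg {n k : ℕ} [NeZero k] {γ : Fin (n / 2 + 1) → ℚ}
    (h : IsGammaExpansion n (P n k) γ) (d : Fin (n / 2 + 1)) : 0 ≤ γ d := by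
  let G : ℝ[X] := ∑ d : Fin (n / 2 + 1), Polynomial.monomial (d : ℕ) (γ d : ℝ)
  have hcoeff : ∀ d : Fin (n / 2 + 1), G.coeff d = γ d := by
    intro d
    simp only [G, Polynomial.finsetSum_coeff, Polynomial.coeff_monomial, Fin.val_inj]
    simp
  have hγ0 : γ 0 = 1 := by
    have h1 := congrArg (Polynomial.coeff · 0) h
    simp only [Polynomial.finsetSum_coeff, Polynomial.coeff_smul, smul_eq_mul, coeff_P] at h1
    rw [Finset.sum_eq_single 0] at h1
    · simpa [Polynomial.coeff_one_add_X_pow] using h1.symm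
    · intro i _ hi
      rw [coeff_X_pow_mul_of_lt (Nat.pos_of_ne_zero (Fin.val_ne_of_ne hi)), mul_zero]
    · simp
  have hG0 : G.eval 0 = 1 := by
    rw [← Polynomial.coeff_zero_eq_eval_zero]
    simpa [hγ0] using hcoeff 0
  have hroots : ∀ w : ℂ, Polynomial.aeval w G = 0 → w.im = 0 ∧ w.re ≤ 0 := by
    intro w hw
    have hwne : w ≠ 0 := by
      rintro rfl
      have := Polynomial.aeval_algebraMap_apply ℂ (0 : ℝ) G
      rw [map_zero, Polynomial.coe_aeval_eq_eval, hG0, hw] at this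
      simp at this
    obtain ⟨z, hz⟩ := exists_eq_mul_one_add_sq hwne
    have hP : Polynomial.aeval z (P n k) = 0 := by
      have h2 : Polynomial.aeval z (P n k) = (1 + z) ^ n * Polynomial.aeval w G := by
        conv_lhs => rw [h]
        simp only [G, map_sum, map_smul, map_mul, map_pow, map_add, map_one, Polynomial.aeval_X,
          Polynomial.aeval_monomial, Finset.mul_sum]
        refine Finset.sum_congr rfl fun d _ => ?_
        have hd : n = 2 * (d : ℕ) + (n - 2 * (d : ℕ)) := by have := d.2; omega
        have h3 : z ^ (d : ℕ) * (1 + z) ^ (n - 2 * (d : ℕ)) = (1 + z) ^ n * w ^ (d : ℕ) := by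
          have h4 : (1 + z) ^ n =
              ((1 + z) ^ 2) ^ (d : ℕ) * (1 + z) ^ (n - 2 * (d : ℕ)) := by
            rw [← pow_mul, ← pow_add, ← hd]
          have h5 : z ^ (d : ℕ) = w ^ (d : ℕ) * ((1 + z) ^ 2) ^ (d : ℕ) := by
            rw [← mul_pow, ← hz]
          rw [h4, h5]
          ring
        rw [h3, Algebra.smul_def]
        simp
        ring
      rw [h2, hw, mul_zero]
    obtain ⟨him, hre⟩ := im_eq_zero_and_re_neg_of_aeval_P_eq_zero n k hP
    have hzr : z = (z.re : ℂ) := Complex.ext rfl (by simpa using him)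
    -- If z = -1, the relation z = w (1 + z)² would give z = 0.
    have hne : (1 + z.re) ≠ 0 := by
      intro h0
      have h1 : 1 + z = 0 := by rw [hzr]; exact_mod_cast h0
      rw [h1] at hz
      rw [hz] at hre
      simp at hre
    have hw' : w = ((z.re / (1 + z.re) ^ 2 : ℝ) : ℂ) := by
      push_cast
      rw [← hzr, eq_div_iff]
      · exact hz.symm
      · rw [hzr]
        exact_mod_cast pow_ne_zero 2 hne
    rw [hw']
    exact ⟨Complex.ofReal_im _, by
      rw [Complex.ofReal_re]
      exact div_nonpos_of_nonpos_of_nonneg hre.le (sq_nonneg _)⟩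
  have := coeff_nonneg_of_zeros_real_nonpos G (by rw [hG0]; exact one_pos) hroots d
  rw [hcoeff] at this
  exact_mod_cast this

/-! ### Restriction to finitely many variables -/

/-- Specialization of a symmetric function to `N` variables. -/
noncomputable def restrict (N : ℕ) : Lam →ₐ[ℚ] MvPowerSeries (Fin N) ℚ :=
  (MvPowerSeries.killCompl Fin.valEmbedding).comp Lam.val

theorem twoVar_eq_restrict (f : Lam) : twoVar f = restrict 2 f := rfl

theorem coeff_restrict (N : ℕ) (f : Lam) (α : Fin N →₀ ℕ) :
    MvPowerSeries.coeff α (restrict N f) =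
      MvPowerSeries.coeff (α.embDomain Fin.valEmbedding) f.1 :=
  MvPowerSeries.coeff_killCompl _ _

theorem sum_single_one_apply {σ : Type*} [DecidableEq σ] (t : Finset σ) (j : σ) :
    (∑ i ∈ t, Finsupp.single i 1 : σ →₀ ℕ) j = if j ∈ t then 1 else 0 := by
  rw [Finsupp.finsetSum_apply]
  simp [Finsupp.single_apply]

theorem exponents_embDomain_valEmbedding {N : ℕ} (α : Fin N →₀ ℕ) :
    exponents (α.embDomain Fin.valEmbedding) = α.support.val.map α := by
  simp only [exponents, Finsupp.support_embDomain, Finset.map_val, Multiset.map_map]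
  refine Multiset.map_congr rfl fun i _ => ?_
  exact Finsupp.embDomain_apply_self Fin.valEmbedding α i

theorem restrict_e (N r : ℕ) :
    restrict N (e r) = (MvPolynomial.esymm (Fin N) ℚ r : MvPowerSeries (Fin N) ℚ) := by
  classical
  ext α
  rw [coeff_restrict, MvPolynomial.coeff_coe, MvPolynomial.esymm_eq_sum_monomial,
    MvPolynomial.coeff_sum]
  simp only [MvPolynomial.coeff_monomial]
  change (if exponents (α.embDomain Fin.valEmbedding) = Multiset.replicate r 1 then 1 else 0 : ℚ)
    = _
  rw [exponents_embDomain_valEmbedding]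
  have hsupp : ∀ t : Finset (Fin N), (∑ i ∈ t, Finsupp.single i 1 : Fin N →₀ ℕ).support = t := by
    intro t
    ext j
    rw [Finsupp.mem_support_iff, sum_single_one_apply]
    simp
  split_ifs with h
  · rw [Multiset.eq_replicate, Multiset.card_map, Finset.card_val] at h
    have hα : ∑ i ∈ α.support, Finsupp.single i 1 = α := by
      ext j
      rw [sum_single_one_apply]
      split_ifs with hj
      · exact (h.2 _ (Multiset.mem_map_of_mem α hj)).symm
      · exact (Finsupp.notMem_support_iff.mp hj).symm
    rw [Finset.sum_eq_single α.support, if_pos hα]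
    · intro t _ ht
      refine if_neg fun h' => ht ?_
      rw [← h', hsupp]
    · intro h'
      exact absurd (Finset.mem_powersetCard.mpr ⟨Finset.subset_univ _, h.1⟩) h'
  · symm
    refine Finset.sum_eq_zero fun t ht => if_neg ?_
    rintro rfl
    apply h
    rw [hsupp, Multiset.eq_replicate, Multiset.card_map, Finset.card_val]
    refine ⟨(Finset.mem_powersetCard.mp ht).2, fun b hb => ?_⟩
    obtain ⟨i, hi, rfl⟩ := Multiset.mem_map.mp hb
    rw [sum_single_one_apply, if_pos (Finset.mem_val.mp hi)]

theorem restrict_ePart (N : ℕ) {n : ℕ} (μ : n.Partition) :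
    restrict N (ePart μ) =
      (MvPolynomial.esymmPart (Fin N) ℚ μ : MvPowerSeries (Fin N) ℚ) := by
  rw [← MvPolynomial.coeToMvPowerSeries.ringHom_apply, ePart, MvPolynomial.esymmPart,
    map_multiset_prod, map_multiset_prod, Multiset.map_map, Multiset.map_map]
  congr 1
  exact Multiset.map_congr rfl fun r _ => restrict_e N r

/-! ### The `e_λ` form a basis -/

/-- The vector of multiplicities of the parts `1, …, n` of a partition of `n`. -/
noncomputable def multiplicities {n : ℕ} (μ : n.Partition) : Fin n →₀ ℕ :=
  Finsupp.equivFunOnFinite.symm fun i => μ.parts.count ((i : ℕ) + 1)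

theorem multiplicities_injective (n : ℕ) :
    Function.Injective (multiplicities : n.Partition → Fin n →₀ ℕ) := by
  intro μ ν h
  refine Nat.Partition.ext (Multiset.ext.mpr fun p => ?_)
  by_cases hp : 0 < p ∧ p ≤ n
  · have := DFunLike.congr_fun h ⟨p - 1, by omega⟩
    simpa [multiplicities, Nat.sub_add_cancel hp.1] using this
  · have hzero : ∀ κ : n.Partition, κ.parts.count p = 0 := fun κ =>
      Multiset.count_eq_zero.mpr fun hmem => hp ⟨κ.parts_pos hmem, by
        have := Multiset.le_sum_of_mem hmem
        rwa [κ.parts_sum] at this⟩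
    rw [hzero, hzero]

/-- `esymmAlgHom` sends the variable with index i to e_{i+1}, so e_μ is the image of the monomial
recording how often each part occurs. -/
theorem esymmPart_eq_esymmAlgHom {n : ℕ} (μ : n.Partition) :
    MvPolynomial.esymmPart (Fin n) ℚ μ =
      (MvPolynomial.esymmAlgHom (Fin n) ℚ n
        (MvPolynomial.monomial (multiplicities μ) 1)).val := by
  classical
  rw [MvPolynomial.esymmAlgHom_apply, MvPolynomial.aeval_monomial, map_one, one_mul,
    MvPolynomial.esymmPart, Finset.prod_multiset_map_count,
    Finsupp.prod_fintype _ _ fun i => pow_zero _]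
  symm
  have hsub : ∀ i : Fin n, (multiplicities μ) i = μ.parts.count ((i : ℕ) + 1) := fun i => rfl
  simp only [hsub]
  rw [Finset.prod_range (n := n) (fun i => MvPolynomial.esymm (Fin n) ℚ (i + 1) ^
      μ.parts.count (i + 1)) |>.symm, Finset.range_eq_Ico,
    Finset.prod_Ico_add' (fun i => MvPolynomial.esymm (Fin n) ℚ i ^ μ.parts.count i) 0 n 1]
  symm
  refine Finset.prod_subset (fun p hp => ?_) fun p _ hp => ?_
  · rw [Multiset.mem_toFinset] at hp
    have h1 := μ.parts_pos hp
    have h2 := Multiset.le_sum_of_mem hp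
    rw [μ.parts_sum] at h2
    exact Finset.mem_Ico.mpr ⟨h1, by omega⟩
  · rw [Multiset.mem_toFinset] at hp
    rw [Multiset.count_eq_zero.mpr hp, pow_zero]

/-- Parts of a partition of n are at most n, so n variables suffice. There e_1, …, e_n are
algebraically independent, and distinct partitions give distinct monomials in them. -/
theorem linearIndependent_ePart (n : ℕ) :
    LinearIndependent ℚ (ePart : n.Partition → Lam) := by
  rw [Fintype.linearIndependent_iff]
  intro c hc
  have h1 := congrArg (restrict n) hc
  simp only [map_sum, map_smul, map_zero, restrict_ePart] at h1
  have h2 : ∑ μ, c μ • MvPolynomial.esymmPart (Fin n) ℚ μ = 0 := by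
    apply MvPolynomial.coe_injective
    rw [MvPolynomial.coe_zero, ← h1, ← MvPolynomial.coeToMvPowerSeries.ringHom_apply, map_sum]
    simp only [MvPolynomial.coeToMvPowerSeries.ringHom_apply, MvPolynomial.coe_smul]
  simp only [esymmPart_eq_esymmAlgHom] at h2
  have h3 : MvPolynomial.esymmAlgHom (Fin n) ℚ n
      (∑ μ, c μ • MvPolynomial.monomial (multiplicities μ) 1) = 0 := by
    apply Subtype.ext
    rw [map_sum]
    simpa using h2
  have h4 := (map_eq_zero_iff _ (MvPolynomial.esymmAlgHom_injective ℚ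
    (Fintype.card_fin n).ge)).mp h3
  have h5 : LinearIndependent ℚ fun μ : n.Partition =>
      (MvPolynomial.monomial (multiplicities μ) 1 : MvPolynomial (Fin n) ℚ) := by
    have := (MvPolynomial.basisMonomials (Fin n) ℚ).linearIndependent.comp _
      (multiplicities_injective n)
    rwa [MvPolynomial.coe_basisMonomials] at this
  exact Fintype.linearIndependent_iff.mp h5 c h4

/-- The homogeneous symmetric functions of degree `n`. -/
def homog (n : ℕ) : Submodule ℚ Lam where
  carrier := {f | ∀ α : ℕ →₀ ℕ, MvPowerSeries.coeff α f.1 ≠ 0 → α.degree = n}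
  zero_mem' := fun α h => absurd rfl h
  add_mem' := by
    intro f g hf hg α h
    by_contra hne
    apply h
    have h1 : MvPowerSeries.coeff α f.1 = 0 := by_contra fun h => hne (hf α h)
    have h2 : MvPowerSeries.coeff α g.1 = 0 := by_contra fun h => hne (hg α h)
    change MvPowerSeries.coeff α (f.1 + g.1) = 0
    rw [map_add, h1, h2, add_zero]
  smul_mem' := by
    intro c f hf α h
    refine hf α fun h0 => h ?_
    change MvPowerSeries.coeff α (c • f.1) = 0
    rw [map_smul, h0, smul_zero]

theorem one_mem_homog : (1 : Lam) ∈ homog 0 := by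
  classical
  intro α h
  by_contra hne
  apply h
  change MvPowerSeries.coeff α (1 : MvPowerSeries ℕ ℚ) = 0
  rw [MvPowerSeries.coeff_one, if_neg]
  rintro rfl
  simp at hne

theorem mul_mem_homog {a b : ℕ} {f g : Lam} (hf : f ∈ homog a) (hg : g ∈ homog b) :
    f * g ∈ homog (a + b) := by
  classical
  intro α h
  change MvPowerSeries.coeff α (f.1 * g.1) ≠ 0 at h
  rw [MvPowerSeries.coeff_mul] at h
  obtain ⟨p, hp, hne⟩ := Finset.exists_ne_zero_of_sum_ne_zero h
  rw [← Finset.HasAntidiagonal.mem_antidiagonal.mp hp, map_add,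
    hf _ (left_ne_zero_of_mul hne), hg _ (right_ne_zero_of_mul hne)]

theorem e_mem_homog (r : ℕ) : e r ∈ homog r := by
  intro α h
  change (if exponents α = Multiset.replicate r 1 then 1 else 0 : ℚ) ≠ 0 at h
  have h1 : exponents α = Multiset.replicate r 1 := by_contra fun h' => h (if_neg h')
  rw [← exponents_sum, h1]
  simp

theorem pow_mem_homog {a : ℕ} {f : Lam} (hf : f ∈ homog a) (N : ℕ) : f ^ N ∈ homog (N * a) := by
  induction N with
  | zero => simpa using one_mem_homog
  | succ N ih =>
    rw [pow_succ, add_one_mul]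
    exact mul_mem_homog ih hf

theorem prod_map_e_mem_homog (s : Multiset ℕ) : (s.map e).prod ∈ homog s.sum := by
  induction s using Multiset.induction_on with
  | empty => simpa using one_mem_homog
  | cons r s ih =>
    rw [Multiset.map_cons, Multiset.prod_cons, Multiset.sum_cons]
    exact mul_mem_homog (e_mem_homog r) ih

theorem ePart_mem_homog {n : ℕ} (μ : n.Partition) : ePart μ ∈ homog n := by
  have := prod_map_e_mem_homog μ.parts
  rwa [μ.parts_sum] at this

theorem rowMap_mem_homog (k : ℕ) [NeZero k] {n : ℕ} {f : Lam} (hf : f ∈ homog (k * n)) :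
    rowMap k f ∈ homog n := by
  intro α h
  have h1 := hf (k • α) h
  rw [map_nsmul, smul_eq_mul] at h1
  exact Nat.eq_of_mul_eq_mul_left (NeZero.pos k) h1

open Classical in
/-- The coefficients of a symmetric function at the monomials whose nonzero exponents form a
partition of `n`. -/
noncomputable def mCoeff (n : ℕ) : Lam →ₗ[ℚ] (n.Partition → ℚ) where
  toFun f μ :=
    -- By symmetry of f the choice of α is immaterial. Every partition is realized by some α, so the
    -- default 0 is never taken.
    if h : ∃ α : ℕ →₀ ℕ, exponents α = μ.parts then MvPowerSeries.coeff h.choose f.1 else 0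
  map_add' f g := by
    funext μ
    simp only [Pi.add_apply]
    split_ifs
    · rfl
    · simp
  map_smul' c f := by
    funext μ
    simp only [Pi.smul_apply, RingHom.id_apply]
    split_ifs
    · rfl
    · simp

theorem eq_zero_of_mCoeff_eq_zero {n : ℕ} {f : Lam} (hf : f ∈ homog n) (h : mCoeff n f = 0) :
    f = 0 := by
  apply Subtype.ext
  ext α
  change MvPowerSeries.coeff α f.1 = 0
  by_contra hne
  have hpos : ∀ {i : ℕ}, i ∈ exponents α → 0 < i := by
    intro i hi
    obtain ⟨j, hj, rfl⟩ := Multiset.mem_map.mp hi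
    exact Nat.pos_of_ne_zero (Finsupp.mem_support_iff.mp hj)
  have hex : ∃ β : ℕ →₀ ℕ, exponents β = exponents α := ⟨α, rfl⟩
  have h1 := congrFun h ⟨exponents α, hpos, (exponents_sum α).trans (hf α hne)⟩
  replace h1 : MvPowerSeries.coeff hex.choose f.1 = 0 := (dif_pos hex).symm.trans h1
  obtain ⟨σ, hσ⟩ := exists_perm_of_exponents_eq hex.choose_spec
  apply hne
  rw [← hσ, coeff_embDomain, h1]

/-- A dimension count replaces the triangularity between the e_λ and the m_μ. Taking monomial
coefficients of Σ c_λ e_λ is an injective endomorphism of a finite-dimensional space, hence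
surjective; so some combination has the same coefficients as f. -/
theorem exists_isEExpansion {n : ℕ} {f : Lam} (hf : f ∈ homog n) :
    ∃ c : n.Partition → ℚ, IsEExpansion f c := by
  let Φ : (n.Partition → ℚ) →ₗ[ℚ] Lam := Fintype.linearCombination ℚ ePart
  have hΦ : ∀ c, Φ c = ∑ μ, c μ • ePart μ := Fintype.linearCombination_apply ℚ ePart
  have hmem : ∀ c, Φ c ∈ homog n := fun c => by
    rw [hΦ]
    exact Submodule.sum_mem _ fun μ _ => Submodule.smul_mem _ _ (ePart_mem_homog μ)
  have hinj : Function.Injective (mCoeff n ∘ₗ Φ) := by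
    rw [injective_iff_map_eq_zero]
    intro c hc
    have h1 := eq_zero_of_mCoeff_eq_zero (hmem c) hc
    rw [hΦ] at h1
    exact funext (Fintype.linearIndependent_iff.mp (linearIndependent_ePart n) c h1)
  obtain ⟨c, hc⟩ := LinearMap.injective_iff_surjective.mp hinj (mCoeff n f)
  refine ⟨c, ?_⟩
  rw [IsEExpansion, ← hΦ, ← sub_eq_zero]
  refine eq_zero_of_mCoeff_eq_zero (Submodule.sub_mem _ hf (hmem c)) ?_
  rw [map_sub, sub_eq_zero]
  exact hc.symm

theorem IsEExpansion.unique {n : ℕ} {f : Lam} {c c' : n.Partition → ℚ}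
    (h : IsEExpansion f c) (h' : IsEExpansion f c') : c' = c := by
  have h1 : ∑ μ, (c' μ - c μ) • ePart μ = 0 := by
    simp only [sub_smul, Finset.sum_sub_distrib]
    rw [← h', ← h, sub_self]
  funext μ
  exact sub_eq_zero.mp (Fintype.linearIndependent_iff.mp (linearIndependent_ePart n) _ h1 μ)

/-! ### Specialization to two variables -/

theorem restrict_two_e_one :
    restrict 2 (e 1) = (MvPowerSeries.X 0 + MvPowerSeries.X 1 : MvPowerSeries (Fin 2) ℚ) := by
  rw [restrict_e, MvPolynomial.esymm_one, Fin.sum_univ_two, MvPolynomial.coe_add,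
    MvPolynomial.coe_X, MvPolynomial.coe_X]

theorem restrict_two_e_two :
    restrict 2 (e 2) = (MvPowerSeries.X 0 * MvPowerSeries.X 1 : MvPowerSeries (Fin 2) ℚ) := by
  have : MvPolynomial.esymm (Fin 2) ℚ 2 = MvPolynomial.X 0 * MvPolynomial.X 1 := by
    have h := Finset.powersetCard_self (Finset.univ : Finset (Fin 2))
    rw [Finset.card_univ, Fintype.card_fin] at h
    rw [MvPolynomial.esymm, h, Finset.sum_singleton, Fin.prod_univ_two]
  rw [restrict_e, this, MvPolynomial.coe_mul, MvPolynomial.coe_X, MvPolynomial.coe_X]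

theorem restrict_e_eq_zero {N r : ℕ} (h : N < r) : restrict N (e r) = 0 := by
  rw [restrict_e, MvPolynomial.esymm, Finset.powersetCard_eq_empty.mpr (by simpa using h),
    Finset.sum_empty, MvPolynomial.coe_zero]

theorem restrict_ePart_eq_zero {N n : ℕ} {μ : n.Partition} {r : ℕ} (hr : r ∈ μ.parts)
    (h : N < r) : restrict N (ePart μ) = 0 := by
  rw [ePart, map_multiset_prod, Multiset.map_map]
  exact Multiset.prod_eq_zero (Multiset.mem_map.mpr ⟨r, hr, restrict_e_eq_zero h⟩)

theorem restrict_two_ePart_twoOne (n : ℕ) (d : Fin (n / 2 + 1)) :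
    restrict 2 (ePart (twoOne n d)) =
      (MvPowerSeries.X 0 * MvPowerSeries.X 1) ^ (d : ℕ) *
        (MvPowerSeries.X 0 + MvPowerSeries.X 1) ^ (n - 2 * (d : ℕ)) := by
  simp [ePart, twoOne, restrict_two_e_one, restrict_two_e_two]

theorem twoOne_injective (n : ℕ) : Function.Injective (twoOne n) := by
  intro d d' h
  have h1 := congrArg (fun μ : n.Partition => μ.parts.count 2) h
  simpa [twoOne, Multiset.count_replicate, Fin.val_inj] using h1

theorem exists_twoOne_eq {n : ℕ} {μ : n.Partition} (h : ∀ r ∈ μ.parts, r ≤ 2) :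
    ∃ d, twoOne n d = μ := by
  have h1 : μ.parts =
      Multiset.replicate (μ.parts.count 2) 2 + Multiset.replicate (μ.parts.count 1) 1 := by
    ext p
    rw [Multiset.count_add, Multiset.count_replicate, Multiset.count_replicate]
    by_cases hp : p ∈ μ.parts
    · have h2 := μ.parts_pos hp
      have h3 := h p hp
      obtain rfl | rfl : p = 1 ∨ p = 2 := by omega
      · simp
      · simp
    · rw [Multiset.count_eq_zero.mpr hp]
      split_ifs with h2 h3 h3
      · omega
      · rw [h2, Multiset.count_eq_zero.mpr hp]
      · rw [h3, Multiset.count_eq_zero.mpr hp]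
      · rfl
  have h2 : μ.parts.count 2 * 2 + μ.parts.count 1 = n := by
    have h3 := congrArg Multiset.sum h1
    rw [μ.parts_sum, Multiset.sum_add, Multiset.sum_replicate, Multiset.sum_replicate] at h3
    simpa using h3.symm
  refine ⟨⟨μ.parts.count 2, by omega⟩, Nat.Partition.ext ?_⟩
  conv_rhs => rw [h1]
  change Multiset.replicate (μ.parts.count 2) 2 +
    Multiset.replicate (n - 2 * μ.parts.count 2) 1 = _
  congr 2
  omega

theorem IsEExpansion.isTwoVarExpansion {n : ℕ} {f : Lam} {c : n.Partition → ℚ}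
    (h : IsEExpansion f c) : IsTwoVarExpansion n f fun d => c (twoOne n d) := by
  rw [IsTwoVarExpansion, twoVar_eq_restrict, h, map_sum]
  symm
  refine Finset.sum_of_injOn (twoOne n) (twoOne_injective n).injOn
    (fun _ _ => Finset.mem_coe.mpr (Finset.mem_univ _)) ?_ ?_
  · intro μ _ hμ
    have : ¬ ∀ r ∈ μ.parts, r ≤ 2 := fun h' => by
      obtain ⟨d, hd⟩ := exists_twoOne_eq h'
      exact hμ ⟨d, Finset.mem_coe.mpr (Finset.mem_univ _), hd⟩
    push Not at this
    obtain ⟨r, hr, hlt⟩ := this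
    rw [map_smul, restrict_ePart_eq_zero hr hlt, smul_zero]
  · intro d _
    rw [map_smul, restrict_two_ePart_twoOne]

theorem X_add_X_pow_eq_homogenize (N : ℕ) :
    ((MvPolynomial.X 0 + MvPolynomial.X 1) ^ N : MvPolynomial (Fin 2) ℚ) =
      ((1 + Polynomial.X) ^ N : ℚ[X]).homogenize N := by
  symm
  refine Polynomial.homogenize_eq_of_isHomogeneous ?_ ?_
  · have h := ((MvPolynomial.isHomogeneous_X ℚ (0 : Fin 2)).add
      (MvPolynomial.isHomogeneous_X ℚ (1 : Fin 2))).pow N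
    rwa [one_mul] at h
  · simp [add_comm]

/-- The coefficient of x^a y^b on the left is that of x^{ka} y^{kb} in (x + y)^{kn}: it is C(kn, ka)
if a + b = n and 0 otherwise. -/
theorem restrict_two_rowMap (k n : ℕ) [NeZero k] :
    restrict 2 (rowMap k (e 1 ^ (k * n))) =
      ((P n k).homogenize n : MvPolynomial (Fin 2) ℚ) := by
  have hk : 0 < k := NeZero.pos k
  ext α
  have h1 : MvPowerSeries.coeff α (restrict 2 (rowMap k (e 1 ^ (k * n)))) =
      MvPowerSeries.coeff (k • α) (restrict 2 (e 1 ^ (k * n))) := by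
    rw [coeff_restrict, coeff_restrict]
    change MvPowerSeries.coeff (k • α.embDomain Fin.valEmbedding) (e 1 ^ (k * n) : Lam).1 = _
    congr 2
    ext i
    by_cases hi : i ∈ Set.range (Fin.valEmbedding : Fin 2 ↪ ℕ)
    · obtain ⟨j, rfl⟩ := hi
      rw [Finsupp.smul_apply, Finsupp.embDomain_apply_self, Finsupp.embDomain_apply_self,
        Finsupp.smul_apply]
    · rw [Finsupp.smul_apply, Finsupp.embDomain_of_notMem_range _ _ _ hi,
        Finsupp.embDomain_of_notMem_range _ _ _ hi, smul_zero]
  have h2 : restrict 2 (e 1 ^ (k * n)) =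
      (((MvPolynomial.X 0 + MvPolynomial.X 1) ^ (k * n) : MvPolynomial (Fin 2) ℚ) :
        MvPowerSeries (Fin 2) ℚ) := by
    rw [map_pow, restrict_two_e_one, MvPolynomial.coe_pow, MvPolynomial.coe_add,
      MvPolynomial.coe_X, MvPolynomial.coe_X]
  rw [h1, h2, MvPolynomial.coeff_coe, MvPolynomial.coeff_coe, X_add_X_pow_eq_homogenize,
    Polynomial.coeff_homogenize, Polynomial.coeff_homogenize, coeff_P,
    Polynomial.coeff_one_add_X_pow]
  have h3 : (k • α) 0 + (k • α) 1 = k * (α 0 + α 1) := by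
    simp [mul_add]
  simp only [h3, Nat.mul_right_inj hk.ne']
  simp only [Finsupp.smul_apply, smul_eq_mul, mul_comm k]

theorem IsTwoVarExpansion.isGammaExpansion {k n : ℕ} [NeZero k] {γ : Fin (n / 2 + 1) → ℚ}
    (h : IsTwoVarExpansion n (rowMap k (e 1 ^ (k * n))) γ) : IsGammaExpansion n (P n k) γ := by
  have h1 : (P n k).homogenize n = ∑ d : Fin (n / 2 + 1),
      γ d • ((MvPolynomial.X 0 * MvPolynomial.X 1) ^ (d : ℕ) *
        (MvPolynomial.X 0 + MvPolynomial.X 1) ^ (n - 2 * (d : ℕ))) := by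
    apply MvPolynomial.coe_injective
    rw [← restrict_two_rowMap, ← twoVar_eq_restrict, h,
      ← MvPolynomial.coeToMvPowerSeries.ringHom_apply, map_sum]
    simp
  -- Setting y = 1 undoes the homogenization, since P_{n,k} has degree at most n.
  have h2 := congrArg (MvPolynomial.aeval ![(Polynomial.X : ℚ[X]), 1]) h1
  rw [Polynomial.aeval_homogenize_X_one _ (natDegree_P n k).le] at h2
  rw [IsGammaExpansion, h2]
  simp [add_comm]

end SymFn

theorem mainTheorem12 (k n : ℕ) [NeZero k] :
    ∃ (c : n.Partition → ℚ) (γ : Fin (n / 2 + 1) → ℚ),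
      -- `c` is the family of coefficients of `ρ_k(e_1^{kn})` in the basis `e_λ`, `λ ⊢ n`
      (SymFn.IsEExpansion (SymFn.rowMap k (SymFn.e 1 ^ (k * n))) c ∧
        ∀ c' : n.Partition → ℚ,
          SymFn.IsEExpansion (SymFn.rowMap k (SymFn.e 1 ^ (k * n))) c' → c' = c) ∧
      -- `γ` is determined by the specialization of `ρ_k(e_1^{kn})` to two variables
      (SymFn.IsTwoVarExpansion n (SymFn.rowMap k (SymFn.e 1 ^ (k * n))) γ ∧
        ∀ γ' : Fin (n / 2 + 1) → ℚ,
          SymFn.IsTwoVarExpansion n (SymFn.rowMap k (SymFn.e 1 ^ (k * n))) γ' → γ' = γ) ∧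
      -- `γ_d` is the coefficient of `e_{2^d 1^{n-2d}}`
      (∀ d, c (SymFn.twoOne n d) = γ d) ∧
      -- `γ` is the vector of gamma coefficients of `P_{n,k}`
      (SymFn.IsGammaExpansion n (SymFn.P n k) γ ∧
        ∀ γ' : Fin (n / 2 + 1) → ℚ, SymFn.IsGammaExpansion n (SymFn.P n k) γ' → γ' = γ) ∧
      -- nonnegativity
      (∀ d, 0 ≤ γ d) ∧
      -- `P_{n,k}` is the `k`-th Veronese section of `(1 + z)^{kn}`
      SymFn.P n k = Polynomial.contract k ((1 + Polynomial.X) ^ (k * n)) ∧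
      -- `P_{n,k}` is palindromic of degree `n`
      (SymFn.P n k).natDegree = n ∧ (SymFn.P n k).reverse = SymFn.P n k ∧
      -- all complex zeros of `P_{n,k}` are real and negative
      ∀ z : ℂ, Polynomial.aeval z (SymFn.P n k) = 0 → z.im = 0 ∧ z.re < 0 := by
  have hmem : SymFn.rowMap k (SymFn.e 1 ^ (k * n)) ∈ SymFn.homog n := by
    refine SymFn.rowMap_mem_homog k ?_
    simpa using SymFn.pow_mem_homog (SymFn.e_mem_homog 1) (k * n)
  obtain ⟨c, hc⟩ := SymFn.exists_isEExpansion hmem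
  have htwo := hc.isTwoVarExpansion
  have hgamma := htwo.isGammaExpansion
  exact ⟨c, fun d => c (SymFn.twoOne n d), ⟨hc, fun _ h => hc.unique h⟩,
    -- Uniqueness in two variables is inherited from one variable, because each two-variable
    -- expansion dehomogenizes to a gamma expansion with the same coefficients.
    ⟨htwo, fun _ h => hgamma.unique h.isGammaExpansion⟩, fun _ => rfl,
    ⟨hgamma, fun _ h => hgamma.unique h⟩, hgamma.nonneg, SymFn.P_eq_contract n k,
    SymFn.natDegree_P n k, SymFn.reverse_P n k,
    fun _ h => SymFn.im_eq_zero_and_re_neg_of_aeval_P_eq_zero n k h⟩
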